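/- Let $G$ be a locally compact, $\sigma$-compact topological group (for instance, any compact group). A $G$-space is a topological space with a continuous action of $G$; $G$-maps are continuous equivariant maps, $G$-homotopies are homotopies $X\times I\to Y$ through $G$-maps, and $[X,Y]_G$ is the set of $G$-homotopy classes of $G$-maps $X\to Y$. Let $K_G$ be a class of $G$-spaces that contains all metrizable $G$-spaces and consists of paracompact Hausdorff $G$-spaces (for instance, the class of all metrizable $G$-spaces). A $G$-space $P\in K_G$ is a $G$-ANR if, whenever $P$ is a closed invariant subset of some $Z\in K_G$, some invariant neighborhood of $P$ in $Z$ admits a $G$-retraction to $P$. A $G$-shape morphism $X\to Y$ is a family of maps $[Y,P]_G\to[X,P]_G$, one for each $G$-ANR $P$, that is natural with respect to $G$-maps $P\to Q$ of $G$-ANRs. Two $G$-spaces $X,Y$ are weakly equivariantly shape comparable if there are $G$-shape morphisms $X\to Y$ and $Y\to X$; $wes(Y)$ is the class of all $G$-spaces weakly equivariantly shape comparable with $Y$, and $\{*\}$ is the one-point $G$-space. An inverse $G$-ANR system $\underline X=\{X_\alpha,p_{\alpha\alpha'},A\}$ consists of $G$-ANRs $X_\alpha$ indexed by a nonempty directed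 set $A$ and $G$-maps $p_{\alpha\alpha'}:X_{\alpha'}\to X_\alpha$ ($\alpha\le\alpha'$) that are compatible up to $G$-homotopy. It is associated with $X$ if there are $G$-maps $p_\alpha:X\to X_\alpha$ with $p_\alpha\simeq_G p_{\alpha\alpha'}p_{\alpha'}$ such that, for every $G$-ANR $P$, (1) every $G$-map $f:X\to P$ satisfies $f\simeq_G h p_\alpha$ for some $\alpha$ and some $G$-map $h:X_\alpha\to P$, and (2) if $\varphi p_\alpha\simeq_G\psi p_\alpha$ for $G$-maps $\varphi,\psi:X_\alpha\to P$, then $\varphi p_{\alpha\alpha'}\simeq_G\psi p_{\alpha\alpha'}$ for some $\alpha'\ge\alpha$. A morphism $\{X_\alpha,p_{\alpha\alpha'},A\}\to\{Y_\beta,q_{\beta\beta'},B\}$ consists of a function $\varphi:B\to A$ and $G$-maps $f_\beta:X_{\varphi(\beta)}\to Y_\beta$ such that for all $\beta\le\beta'$ there is $\alpha\ge\varphi(\beta),\varphi(\beta')$ with $f_\beta\, p_{\varphi(\beta)\alpha}\simeq_G q_{\beta\beta'}f_{\beta'}\,p_{\varphi(\beta')\alpha}$. **Proposition.** (a) Every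 $G$-space that has a $G$-fixed point belongs to $wes(*)$. (b) A paracompact Hausdorff $G$-space $X$ (in particular, any $X\in K_G$) belongs to $wes(*)$ if and only if it has a $G$-fixed point. (c) The same holds when shape morphisms are described by systems: if $X$ is a paracompact Hausdorff $G$-space and $\underline X$, $\underline{*}$ are inverse $G$-ANR systems associated with $X$ and with $\{*\}$, then there are morphisms of systems $\underline X\to\underline{*}$ and $\underline{*}\to\underline X$ if and only if $X$ has a $G$-fixed point. -/

import Mathlib

open Topology TopologicalSpace

universe u

/-- A `G`-space: a topological space with a continuous action `G × X → X` of the group `G`. -/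
structure GSpace (G : Type u) [Group G] [TopologicalSpace G] where
  carrier : Type u
  [top : TopologicalSpace carrier]
  [act : MulAction G carrier]
  [cont : ContinuousSMul G carrier]

namespace GSpace

variable {G : Type u} [Group G] [TopologicalSpace G]

instance : CoeSort (GSpace G) (Type u) := ⟨GSpace.carrier⟩

attribute [instance] GSpace.top GSpace.act GSpace.cont

/-- The one-point `G`-space. -/
def point (G : Type u) [Group G] [TopologicalSpace G] : GSpace G where
  carrier := PUnit.{u + 1}
  cont := ⟨continuous_const⟩

/-- Equivariance of a continuous map between `G`-spaces. -/
def IsEquivariant (X Y : GSpace G) (f : C(X, Y)) : Prop :=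
  ∀ (g : G) (x : X), f (g • x) = g • f x

/-- `G`-maps: continuous equivariant maps. -/
def Map (X Y : GSpace G) : Type u := {f : C(X, Y) // IsEquivariant X Y f}

/-- The identity `G`-map. -/
def Map.id (X : GSpace G) : Map X X := ⟨ContinuousMap.id X, fun _ _ => rfl⟩

/-- The composition `h ∘ f` of `G`-maps. -/
def Map.comp {X Y Z : GSpace G} (h : Map Y Z) (f : Map X Y) : Map X Z :=
  ⟨h.1.comp f.1, fun g x => by
    rw [ContinuousMap.comp_apply, f.2 g x, h.2 g (f.1 x), ContinuousMap.comp_apply]⟩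

/-- `G`-homotopy of `G`-maps: a homotopy through `G`-maps, that is, a homotopy
`I × X → Y` that is equivariant for the trivial action of `G` on `I`. -/
def GHomotopic {X Y : GSpace G} (f₀ f₁ : Map X Y) : Prop :=
  ContinuousMap.HomotopicWith f₀.1 f₁.1 (IsEquivariant X Y)

/-- `G`-homotopy is an equivalence relation. -/
instance homotopySetoid (X Y : GSpace G) : Setoid (Map X Y) where
  r := GHomotopic
  iseqv :=
    ⟨fun f => ContinuousMap.HomotopicWith.refl f.1 f.2,
      fun h => ContinuousMap.HomotopicWith.symm h,
      fun h h' => ContinuousMap.HomotopicWith.trans h h'⟩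

/-- The set `[X, Y]_G` of `G`-homotopy classes of `G`-maps. -/
def HClass (X Y : GSpace G) : Type u := Quotient (homotopySetoid X Y)

/-- Composing with a fixed `G`-map on the left preserves `G`-homotopy. -/
theorem GHomotopic.comp_left {X Y Z : GSpace G} (h : Map Y Z) {f₀ f₁ : Map X Y}
    (H : GHomotopic f₀ f₁) : GHomotopic (h.comp f₀) (h.comp f₁) := by
  obtain ⟨F⟩ := H
  refine ⟨⟨⟨h.1.comp F.toContinuousMap, ?_, ?_⟩, ?_⟩⟩
  · intro x
    exact congrArg h.1 (F.map_zero_left x)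
  · intro x
    exact congrArg h.1 (F.map_one_left x)
  · intro t g x
    have hF := F.prop' t g x
    exact (congrArg h.1 hF).trans (h.2 g _)

/-- The map `[X, P]_G → [X, Q]_G` that sends `[f]` to `[h ∘ f]`. -/
def HClass.post {X P Q : GSpace G} (h : Map P Q) : HClass X P → HClass X Q :=
  Quotient.map h.comp fun _ _ H => GHomotopic.comp_left h H

/-- `Y` is a `G`-absolute neighborhood retract for the class `K` of `G`-spaces: `Y` belongs to
`K` and, whenever `Y` is embedded as a closed invariant subset of a `G`-space `Z` of `K`, there
are an invariant neighborhood `U` of `Y` in `Z` and a `G`-retraction of `U` to `Y`. -/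
def IsGANR (K : Set (GSpace G)) (Y : GSpace G) : Prop :=
  Y ∈ K ∧ ∀ Z ∈ K, ∀ i : Map Y Z, IsClosedEmbedding i.1 →
    ∃ (U : Set Z) (hU : ∀ (g : G), ∀ z ∈ U, g • z ∈ U) (_ : U ∈ 𝓝ˢ (Set.range i.1))
      (r : C(U, Y)),
      (∀ (g : G) (z : U), r ⟨g • z.1, hU g z.1 z.2⟩ = g • r z) ∧
      ∀ (y : Y) (hy : i.1 y ∈ U), r ⟨i.1 y, hy⟩ = y

/-- A `G`-shape morphism from `X` to `Y` (with respect to the `G`-ANRs for the class `K`): it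
assigns to every `G`-homotopy class `Y → P` into a `G`-ANR `P` a `G`-homotopy class `X → P`,
naturally in `P`. -/
structure ShapeMorphism (K : Set (GSpace G)) (X Y : GSpace G) where
  app : ∀ P : GSpace G, IsGANR K P → HClass Y P → HClass X P
  naturality : ∀ (P Q : GSpace G) (hP : IsGANR K P) (hQ : IsGANR K Q) (h : Map P Q)
    (c : HClass Y P), app Q hQ (c.post h) = (app P hP c).post h

/-- `X` and `Y` are weakly equivariantly shape comparable: there are `G`-shape morphisms in both
directions. -/
def WeaklyShapeComparable (K : Set (GSpace G)) (X Y : GSpace G) : Prop :=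
  Nonempty (ShapeMorphism K X Y) ∧ Nonempty (ShapeMorphism K Y X)

/-- The weak equivariant shape comparability class of `X`. -/
def wes (K : Set (GSpace G)) (X : GSpace G) : Set (GSpace G) :=
  {Y | WeaklyShapeComparable K X Y}

/-- An inverse `G`-ANR system, indexed by a directed set. The bonding maps are only required to be
compatible up to `G`-homotopy, so inverse systems of `G`-spaces and `G`-maps are included. -/
structure ANRSystem (K : Set (GSpace G)) where
  Idx : Type u
  [preorder : Preorder Idx]
  [nonempty : Nonempty Idx]
  [directed : IsDirectedOrder Idx]
  obj : Idx → GSpace G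
  isGANR : ∀ a, IsGANR K (obj a)
  bond : ∀ {a b : Idx}, a ≤ b → Map (obj b) (obj a)
  bond_refl : ∀ a, GHomotopic (bond (le_refl a)) (Map.id (obj a))
  bond_trans : ∀ {a b c : Idx} (hab : a ≤ b) (hbc : b ≤ c),
    GHomotopic ((bond hab).comp (bond hbc)) (bond (hab.trans hbc))

attribute [instance] ANRSystem.preorder ANRSystem.nonempty ANRSystem.directed

/-- The inverse `G`-ANR system `S` is associated with `X`. -/
def ANRSystem.IsAssociated {K : Set (GSpace G)} (S : ANRSystem K) (X : GSpace G) : Prop :=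
  ∃ p : ∀ a, Map X (S.obj a),
    (∀ (a b : S.Idx) (hab : a ≤ b), GHomotopic (p a) ((S.bond hab).comp (p b))) ∧
    ∀ P : GSpace G, IsGANR K P →
      (∀ f : Map X P, ∃ (a : S.Idx) (h : Map (S.obj a) P), GHomotopic (h.comp (p a)) f) ∧
      ∀ (a : S.Idx) (φ ψ : Map (S.obj a) P), GHomotopic (φ.comp (p a)) (ψ.comp (p a)) →
        ∃ (b : S.Idx) (hab : a ≤ b),
          GHomotopic (φ.comp (S.bond hab)) (ψ.comp (S.bond hab))

/-- A morphism `(f, φ) : S → T` of inverse `G`-ANR systems. -/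
structure ANRSystem.Hom {K : Set (GSpace G)} (S T : ANRSystem K) where
  φ : T.Idx → S.Idx
  f : ∀ b, Map (S.obj (φ b)) (T.obj b)
  compat : ∀ (b c : T.Idx) (hbc : b ≤ c), ∃ (a : S.Idx) (hb : φ b ≤ a) (hc : φ c ≤ a),
    GHomotopic ((f b).comp (S.bond hb)) ((T.bond hbc).comp ((f c).comp (S.bond hc)))

end GSpace

/-! A fixed point of `X` is a `G`-map from the point to `X`, and `G`-maps induce shape morphisms and
morphisms of associated systems. Conversely, either kind of morphism from the point to `X` turns a
`G`-map from `X` to a `G`-ANR `P` into a `G`-map from the point to `P`, that is, a fixed point of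
`P`. So for `X` without fixed points it suffices to map `X` to a fixed-point-free `G`-ANR
(`exists_map_isGANR_fixedPoints_empty`). Take the nonconstant functions in `C(G, B)` under
translation, with `B` an `ℓ¹` space: a translation-invariant function is constant. The map is `x ↦
(g ↦ φ (g • x))`, where `φ : X → B` is nonconstant on every orbit. The `G`-ANR property
(`isGANR_nonconstantSpace`) reduces to the nonequivariant Arens–Dowker theorem. -/

open Filter Set

/-! ### Extension of Banach-valued maps -/

section Extension

variable {A Z : Type*} {B : Type*} [TopologicalSpace A] [TopologicalSpace Z] [T2Space Z]
  [ParacompactSpace Z] [NormedAddCommGroup B] [NormedSpace ℝ B]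

/-- Approximate extension of a map with values in a convex set from a closed subspace of a
paracompact Hausdorff space. -/
theorem IsClosedEmbedding.exists_approx_extension {e : A → Z} (he : IsClosedEmbedding e)
    (f : C(A, B)) {C : Set B} (hC : Convex ℝ C) (h0 : (0 : B) ∈ C) (hf : ∀ a, f a ∈ C)
    {δ : ℝ} (hδ : 0 < δ) :
    ∃ g : C(Z, B), (∀ z, g z ∈ C) ∧ ∀ a, dist (g (e a)) (f a) < δ := by
  have key : ∃ g : C(Z, B), ∀ z, g z ∈ C ∩ ⋂ (a : A) (_ : e a = z), Metric.ball (f a) δ := by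
    refine exists_continuous_forall_mem_convex_of_local_const
      (fun z => hC.inter (convex_iInter₂ fun a _ => convex_ball _ _)) fun z => ?_
    by_cases hz : z ∈ range e
    · obtain ⟨a₀, rfl⟩ := hz
      refine ⟨f a₀, ?_⟩
      have h1 : ∀ᶠ a in 𝓝 a₀, dist (f a₀) (f a) < δ := by
        filter_upwards [f.continuous.continuousAt.eventually (Metric.ball_mem_nhds (f a₀) hδ)]
          with a ha
        rwa [dist_comm]
      rw [he.isInducing.nhds_eq_comap, eventually_comap] at h1
      filter_upwards [h1] with y hy
      exact ⟨hf a₀, mem_iInter₂.2 fun a ha => hy a ha⟩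
    · refine ⟨0, ?_⟩
      filter_upwards [he.isClosed_range.isOpen_compl.mem_nhds hz] with y hy
      -- Off the closed range the ball conditions are vacuous, so any point of `C` serves.
      exact ⟨h0, mem_iInter₂.2 fun a ha => (hy ⟨a, ha⟩).elim⟩
  obtain ⟨g, hg⟩ := key
  exact ⟨g, fun z => (hg z).1, fun a => mem_iInter₂.1 (hg (e a)).2 a rfl⟩

variable [CompleteSpace B]

/-- Tietze's iteration: each approximate extension halves the bound on the error and is itself
bounded on all of `Z` by the previous bound, so the corrections sum uniformly. -/
theorem IsClosedEmbedding.exists_extension_of_norm_le_one {e : A → Z} (he : IsClosedEmbedding e)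
    (f : C(A, B)) (hf : ∀ a, ‖f a‖ ≤ 1) : ∃ F : C(Z, B), ∀ a, F (e a) = f a := by
  let S : ℕ → Type _ := fun n => {f : C(A, B) // ∀ a, ‖f a‖ ≤ (1 / 2 : ℝ) ^ n}
  have step : ∀ (n : ℕ) (f : S n), ∃ g : C(Z, B), (∀ z, ‖g z‖ ≤ (1 / 2 : ℝ) ^ n) ∧
      ∀ a, ‖f.1 a - g (e a)‖ ≤ (1 / 2 : ℝ) ^ (n + 1) := by
    intro n f
    obtain ⟨g, hg, hg'⟩ := IsClosedEmbedding.exists_approx_extension he f.1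
      (convex_closedBall (0 : B) ((1 / 2 : ℝ) ^ n)) (Metric.mem_closedBall_self (by positivity))
      (fun a => mem_closedBall_zero_iff.2 (f.2 a)) (δ := (1 / 2 : ℝ) ^ (n + 1)) (by positivity)
    refine ⟨g, fun z => mem_closedBall_zero_iff.1 (hg z), fun a => ?_⟩
    rw [← dist_eq_norm, dist_comm]
    exact (hg' a).le
  choose g hg hg' using step
  -- `s n` is the error left after `n` corrections.
  let s : ∀ n, S n := fun n => Nat.rec ⟨f, fun a => by simpa using hf a⟩
    (fun n f => ⟨f.1 - (g n f).comp ⟨e, he.continuous⟩, hg' n f⟩) n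
  have hs : ∀ n a, (s (n + 1)).1 a = (s n).1 a - g n (s n) (e a) := fun _ _ => rfl
  have hsum : ∀ n a, ∑ i ∈ Finset.range n, g i (s i) (e a) = f a - (s n).1 a := by
    intro n a
    induction n with
    | zero => simp [s]
    | succ n ih => rw [Finset.sum_range_succ, ih, hs]; abel
  have hgeo : Summable fun n : ℕ => (1 / 2 : ℝ) ^ n := summable_geometric_two
  refine ⟨⟨fun z => ∑' n, g n (s n) z, continuous_tsum (fun n => (g n (s n)).continuous) hgeo
    fun n z => hg n (s n) z⟩, fun a => ?_⟩
  have hsm : Summable fun n => g n (s n) (e a) :=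
    Summable.of_norm_bounded hgeo fun n => hg n (s n) (e a)
  refine tendsto_nhds_unique hsm.hasSum.tendsto_sum_nat ?_
  simp only [hsum]
  have h0 : Tendsto (fun n => (s n).1 a) atTop (𝓝 0) :=
    squeeze_zero_norm (fun n => (s n).2 a) hgeo.tendsto_atTop_zero
  simpa using tendsto_const_nhds.sub h0

/-- **Arens–Dowker extension theorem**: a continuous map into a Banach space extends from a closed
subspace of a paracompact Hausdorff space. -/
theorem IsClosedEmbedding.exists_extension_banach {e : A → Z} (he : IsClosedEmbedding e)
    (f : C(A, B)) : ∃ F : C(Z, B), ∀ a, F (e a) = f a := by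
  -- Subtracting an approximation within `1` reduces to the bounded case.
  obtain ⟨g, -, hg⟩ := IsClosedEmbedding.exists_approx_extension he f convex_univ (mem_univ _)
    (fun _ => mem_univ _) one_pos
  obtain ⟨F, hF⟩ := IsClosedEmbedding.exists_extension_of_norm_le_one he
    (f - g.comp ⟨e, he.continuous⟩) fun a => by
      have := (hg a).le
      rwa [dist_comm, dist_eq_norm] at this
  refine ⟨g + F, fun a => ?_⟩
  simp [hF]

end Extension

/-! ### Morphisms induced by `G`-maps -/

namespace GSpace

variable {G : Type u} [Group G] [TopologicalSpace G]

theorem GHomotopic.comp_right {X Y Z : GSpace G} {h₀ h₁ : Map Y Z} (H : GHomotopic h₀ h₁)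
    (f : Map X Y) : GHomotopic (h₀.comp f) (h₁.comp f) := by
  obtain ⟨F⟩ := H
  refine ⟨⟨⟨F.toContinuousMap.comp ((ContinuousMap.id _).prodMap f.1), ?_, ?_⟩, ?_⟩⟩
  · intro x
    exact F.map_zero_left (f.1 x)
  · intro x
    exact F.map_one_left (f.1 x)
  · intro t g x
    have hF := F.prop' t g (f.1 x)
    exact (congrArg (fun y => F (t, y)) (f.2 g x)).trans hF

theorem GHomotopic.symm {X Y : GSpace G} {f g : Map X Y} (h : GHomotopic f g) :
    GHomotopic g f :=
  ContinuousMap.HomotopicWith.symm h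

theorem GHomotopic.trans {X Y : GSpace G} {f g k : Map X Y} (h : GHomotopic f g)
    (h' : GHomotopic g k) : GHomotopic f k :=
  ContinuousMap.HomotopicWith.trans h h'

/-- The shape morphism induced by a `G`-map. -/
def ShapeMorphism.ofMap (K : Set (GSpace G)) {X Y : GSpace G} (f : Map X Y) :
    ShapeMorphism K X Y where
  app P _ := Quotient.map (fun h : Map Y P => h.comp f) fun _ _ H => GHomotopic.comp_right H f
  naturality P Q hP hQ h c := by
    induction c using Quotient.inductionOn with
    | _ k => rfl

/-- The constant `G`-map at a fixed point. -/
def Map.const (Y : GSpace G) {X : GSpace G} {x : X} (hx : x ∈ MulAction.fixedPoints G X) :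
    Map Y X :=
  ⟨ContinuousMap.const Y x, fun g _ => (hx g).symm⟩

theorem point_mem_fixedPoints :
    (PUnit.unit : point G) ∈ MulAction.fixedPoints G (point G) := fun _ => rfl

theorem Map.fixedPoints_nonempty {X : GSpace G} (f : Map (point G) X) :
    (MulAction.fixedPoints G X).Nonempty :=
  ⟨f.1 PUnit.unit, fun g => (f.2 g PUnit.unit).symm⟩

/-- A `G`-map induces a morphism of associated systems. -/
theorem ANRSystem.IsAssociated.nonempty_hom {K : Set (GSpace G)} {S T : ANRSystem K}
    {X Y : GSpace G} (hS : S.IsAssociated X) (hT : T.IsAssociated Y) (f : Map X Y) :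
    Nonempty (S.Hom T) := by
  obtain ⟨p, hp, hSP⟩ := hS
  obtain ⟨q, hq, -⟩ := hT
  choose φ k hk using fun b => (hSP (T.obj b) (T.isGANR b)).1 ((q b).comp f)
  refine ⟨⟨φ, k, fun b c hbc => ?_⟩⟩
  obtain ⟨a, hb, hc⟩ := exists_ge_ge (φ b) (φ c)
  have h1 : GHomotopic ((k b).comp ((S.bond hb).comp (p a))) ((q b).comp f) :=
    (GHomotopic.comp_left (k b) (hp _ _ hb).symm).trans (hk b)
  have h2 : GHomotopic ((T.bond hbc).comp ((k c).comp ((S.bond hc).comp (p a))))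
      ((T.bond hbc).comp ((q c).comp f)) :=
    GHomotopic.comp_left _ ((GHomotopic.comp_left (k c) (hp _ _ hc).symm).trans (hk c))
  have h3 : GHomotopic ((q b).comp f) ((T.bond hbc).comp ((q c).comp f)) :=
    GHomotopic.comp_right (hq b c hbc) f
  -- The two maps are known to be homotopic only after composition with `p a`; condition (2) moves
  -- this to a bonding map.
  obtain ⟨a', ha, h⟩ := (hSP (T.obj b) (T.isGANR b)).2 a ((k b).comp (S.bond hb))
    ((T.bond hbc).comp ((k c).comp (S.bond hc))) ((h1.trans h3).trans h2.symm)
  refine ⟨a', hb.trans ha, hc.trans ha, ?_⟩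
  exact (GHomotopic.comp_left (k b) (S.bond_trans hb ha).symm).trans
    (h.trans (GHomotopic.comp_left _ (GHomotopic.comp_left _ (S.bond_trans hc ha))))

/-! ### The `G`-ANR of nonconstant functions -/

/-- The functions `G → B` that are not constant. -/
def nonconstant (G B : Type*) [TopologicalSpace G] [TopologicalSpace B] : Set C(G, B) :=
  {u | ∃ g h, u g ≠ u h}

theorem isOpen_nonconstant {G B : Type*} [TopologicalSpace G] [TopologicalSpace B] [T2Space B] :
    IsOpen (nonconstant G B) := by
  have : nonconstant G B = ⋃ (g) (h), {u : C(G, B) | u g ≠ u h} := by ext; simp [nonconstant]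
  rw [this]
  exact isOpen_iUnion fun g => isOpen_iUnion fun h =>
    isOpen_ne_fun (continuous_eval_const g) (continuous_eval_const h)

/-- The action of `G` on the nonconstant functions by right translation of the argument. -/
instance (G B : Type*) [Group G] [TopologicalSpace G] [IsTopologicalGroup G]
    [TopologicalSpace B] : MulAction G (nonconstant G B) where
  smul h u := ⟨⟨fun g => u.1 (g * h), by fun_prop⟩, by
    obtain ⟨g, k, hgk⟩ := u.2
    exact ⟨g * h⁻¹, k * h⁻¹, by simpa using hgk⟩⟩
  one_smul u := Subtype.ext (ContinuousMap.ext fun g => congrArg u.1 (mul_one g))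
  mul_smul h k u := Subtype.ext (ContinuousMap.ext fun g => congrArg u.1 (mul_assoc g h k).symm)

/-- The map `x ↦ (g ↦ φ (g • x))` into the function space. -/
def orbitMap {X : GSpace G} {B : Type*} [TopologicalSpace B] (φ : C(X, B)) : C(X, C(G, B)) :=
  ⟨fun x => ⟨fun g => φ (g • x), by fun_prop⟩,
    ContinuousMap.continuous_of_continuous_uncurry _
      (by
        change Continuous fun x : X × G => φ (x.2 • x.1)
        fun_prop)⟩

theorem orbitMap_apply {X : GSpace G} {B : Type*} [TopologicalSpace B] (φ : C(X, B)) (x : X)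
    (g : G) : orbitMap φ x g = φ (g • x) := rfl

section FunctionSpace

variable [IsTopologicalGroup G] [LocallyCompactSpace G]

/-- The `G`-space of nonconstant functions `G → B` with the compact-open topology, on which `G`
acts by right translation of the argument. -/
def nonconstantSpace (G : Type u) [Group G] [TopologicalSpace G] [IsTopologicalGroup G]
    [LocallyCompactSpace G] (B : Type u) [TopologicalSpace B] : GSpace G where
  carrier := nonconstant G B
  cont := ⟨Continuous.subtype_mk (ContinuousMap.continuous_of_continuous_uncurry
    (fun x : G × nonconstant G B => (x.1 • x.2).1)
    (by
      change Continuous fun x : (G × nonconstant G B) × G => x.1.2.1 (x.2 * x.1.1)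
      fun_prop)) _⟩

theorem nonconstantSpace_smul_apply {B : Type u} [TopologicalSpace B] (h g : G)
    (u : nonconstantSpace G B) : (h • u).1 g = u.1 (g * h) := rfl

/-- A nonconstant function is not fixed by all translations. -/
theorem fixedPoints_nonconstantSpace (B : Type u) [TopologicalSpace B] :
    ¬ (MulAction.fixedPoints G (nonconstantSpace G B)).Nonempty := by
  rintro ⟨u, hu⟩
  have h1 : ∀ g, u.1 g = u.1 1 := fun g => by
    have := nonconstantSpace_smul_apply g 1 u
    rw [hu g, one_mul] at this
    exact this.symm
  obtain ⟨g, k, hgk⟩ := u.2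
  exact hgk ((h1 g).trans (h1 k).symm)

/-- A function `u` is recovered from the values at `1` of its translates. Hence extending evaluation
at `1` to `F` on `Z` makes `orbitMap F` an equivariant extension of the inclusion into `C(G, B)`; it
retracts the preimage of the open set of nonconstant functions. -/
theorem isGANR_nonconstantSpace [SigmaCompactSpace G] {K : Set (GSpace G)}
    (hK_metrizable : ∀ Z : GSpace G, MetrizableSpace Z → Z ∈ K)
    (hK_paracompact : ∀ Z ∈ K, T2Space Z ∧ ParacompactSpace Z)
    (B : Type u) [NormedAddCommGroup B] [NormedSpace ℝ B] [CompleteSpace B] :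
    IsGANR K (nonconstantSpace G B) := by
  -- Local compactness and `σ`-compactness of `G` make the compact-open topology metrizable.
  refine ⟨hK_metrizable _ (inferInstanceAs (MetrizableSpace (nonconstant G B))),
    fun Z hZ i hi => ?_⟩
  obtain ⟨_, _⟩ := hK_paracompact Z hZ
  have hc : Continuous fun u : nonconstantSpace G B => u.1 1 :=
    (continuous_eval_const (F := C(G, B)) (1 : G)).comp continuous_subtype_val
  obtain ⟨F, hF⟩ := IsClosedEmbedding.exists_extension_banach (B := B) hi ⟨_, hc⟩
  have hFi : ∀ y, orbitMap F (i.1 y) = y.1 := fun y => ContinuousMap.ext fun g => by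
    rw [orbitMap_apply, ← i.2 g y, hF]
    exact (nonconstantSpace_smul_apply g 1 y).trans (by rw [one_mul])
  have hU : ∀ (g : G), ∀ z ∈ orbitMap F ⁻¹' nonconstant G B,
      g • z ∈ orbitMap F ⁻¹' nonconstant G B := by
    rintro g z ⟨h, k, hhk⟩
    refine ⟨h * g⁻¹, k * g⁻¹, ?_⟩
    simpa [orbitMap_apply, mul_smul] using hhk
  refine ⟨orbitMap F ⁻¹' nonconstant G B, hU, ?_,
    ⟨fun z => ⟨orbitMap F z.1, z.2⟩,
      ((orbitMap F).continuous.comp continuous_subtype_val).subtype_mk _⟩, fun g z => ?_,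
    fun y hy => Subtype.ext (hFi y)⟩
  · refine (isOpen_nonconstant.preimage (orbitMap F).continuous).mem_nhdsSet.2 ?_
    rintro _ ⟨y, rfl⟩
    rw [mem_preimage, hFi]
    exact y.2
  · refine Subtype.ext (ContinuousMap.ext fun h => ?_)
    exact congrArg F (mul_smul h g z.1).symm

end FunctionSpace

/-! ### Maps nonconstant on orbits -/

/-- The `ℓ¹`-valued map whose coordinates are the functions of a partition of unity. -/
theorem exists_continuousMap_lp_of_partitionOfUnity {ι X : Type*} [TopologicalSpace X]
    (f : PartitionOfUnity ι X) :
    ∃ φ : C(X, lp (fun _ : ι => ℝ) 1), ∀ x i, φ x i = f i x := by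
  classical
  refine ⟨⟨fun x => ∑ᶠ i, f i x • lp.single 1 i (1 : ℝ),
    f.continuous_finsum_smul fun i x _ => continuousAt_const⟩, fun x j => ?_⟩
  have hfin : (Function.support fun i =>
      f i x • lp.single (E := fun _ : ι => ℝ) 1 i (1 : ℝ)).Finite :=
    (f.locallyFinite.point_finite x).subset fun i hi => by
      contrapose! hi
      have h0 : f i x = 0 := by simpa using hi
      simp [h0]
  change lp.evalCLM ℝ (fun _ : ι => ℝ) 1 j (∑ᶠ i, f i x • lp.single 1 i (1 : ℝ)) = f j x
  rw [map_finsum _ hfin, finsum_eq_single _ j]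
  · simp [lp.evalCLM]
  · intro i hi
    simp [lp.evalCLM, hi.symm]

/-- On a paracompact Hausdorff `G`-space without fixed points there is a map to a Banach space
that is not constant on any orbit. -/
theorem exists_continuousMap_nonconstant_on_orbits (X : GSpace G) [T2Space X] [ParacompactSpace X]
    (hX : ¬ (MulAction.fixedPoints G X).Nonempty) :
    ∃ φ : C(X, lp (fun _ : X => ℝ) 1), ∀ x, ∃ g : G, φ (g • x) ≠ φ x := by
  have h1 : ∀ x : X, ∃ g : G, g • x ≠ x := by
    intro x
    by_contra! h
    exact hX ⟨x, h⟩
  choose γ hγ using h1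
  choose V W hV hW hxV hxW hVW using fun x => t2_separation (hγ x)
  -- On the `i`-th member of this cover, `γ i` moves points into `V i`, which misses `W i` and so
  -- the support of `f i`.
  obtain ⟨f, hf⟩ := PartitionOfUnity.exists_isSubordinate isClosed_univ
    (fun x => W x ∩ (γ x • ·) ⁻¹' V x)
    (fun x => (hW x).inter ((hV x).preimage (continuous_const_smul (γ x))))
    fun x _ => mem_iUnion.2 ⟨x, hxW x, hxV x⟩
  obtain ⟨φ, hφ⟩ := exists_continuousMap_lp_of_partitionOfUnity f
  refine ⟨φ, fun x => ?_⟩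
  obtain ⟨i, hi⟩ := f.exists_pos (mem_univ x)
  refine ⟨γ i, fun h => ?_⟩
  have hx := hf i (subset_tsupport _ (Function.mem_support.2 hi.ne'))
  have h2 : f i (γ i • x) ≠ 0 := by
    rw [← hφ, h, hφ]
    exact hi.ne'
  exact (hVW i).le_bot ⟨hx.2, (hf i (subset_tsupport _ (Function.mem_support.2 h2))).1⟩

/-- A paracompact Hausdorff `G`-space without fixed points maps to a `G`-ANR without fixed
points. -/
theorem exists_map_isGANR_fixedPoints_empty [IsTopologicalGroup G] [LocallyCompactSpace G]
    [SigmaCompactSpace G] {K : Set (GSpace G)}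
    (hK_metrizable : ∀ Z : GSpace G, MetrizableSpace Z → Z ∈ K)
    (hK_paracompact : ∀ Z ∈ K, T2Space Z ∧ ParacompactSpace Z)
    (X : GSpace G) [T2Space X] [ParacompactSpace X]
    (hX : ¬ (MulAction.fixedPoints G X).Nonempty) :
    ∃ P : GSpace G, IsGANR K P ∧ ¬ (MulAction.fixedPoints G P).Nonempty ∧ Nonempty (Map X P) := by
  obtain ⟨φ, hφ⟩ := exists_continuousMap_nonconstant_on_orbits X hX
  have hmem : ∀ x, orbitMap φ x ∈ nonconstant G (lp (fun _ : X => ℝ) 1) := fun x => by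
    obtain ⟨g, hg⟩ := hφ x
    exact ⟨g, 1, by simpa [orbitMap_apply] using hg⟩
  refine ⟨nonconstantSpace G (lp (fun _ : X => ℝ) 1),
    isGANR_nonconstantSpace hK_metrizable hK_paracompact _, fixedPoints_nonconstantSpace _,
    ⟨⟨⟨fun x => ⟨orbitMap φ x, hmem x⟩, (orbitMap φ).continuous.subtype_mk _⟩, fun g x => ?_⟩⟩⟩
  exact Subtype.ext (ContinuousMap.ext fun h => congrArg φ (mul_smul h g x).symm)

theorem mem_wes_point_of_fixedPoints_nonempty (K : Set (GSpace G)) {X : GSpace G}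
    (hX : (MulAction.fixedPoints G X).Nonempty) : X ∈ wes K (point G) := by
  obtain ⟨x, hx⟩ := hX
  exact ⟨⟨ShapeMorphism.ofMap K (Map.const _ hx)⟩,
    ⟨ShapeMorphism.ofMap K (Map.const X point_mem_fixedPoints)⟩⟩

end GSpace

theorem mainTheorem10 {G : Type u} [Group G] [TopologicalSpace G] [IsTopologicalGroup G]
    [LocallyCompactSpace G] [SigmaCompactSpace G]
    (K : Set (GSpace G))
    (hK_metrizable : ∀ Z : GSpace G, MetrizableSpace Z → Z ∈ K)
    (hK_paracompact : ∀ Z ∈ K, T2Space Z ∧ ParacompactSpace Z) :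
    (∀ X : GSpace G, (MulAction.fixedPoints G X).Nonempty → X ∈ GSpace.wes K (GSpace.point G)) ∧
    (∀ X : GSpace G, T2Space X → ParacompactSpace X →
      (X ∈ GSpace.wes K (GSpace.point G) ↔ (MulAction.fixedPoints G X).Nonempty)) ∧
    (∀ X : GSpace G, T2Space X → ParacompactSpace X →
      ∀ S T : GSpace.ANRSystem K, S.IsAssociated X → T.IsAssociated (GSpace.point G) →
        ((Nonempty (S.Hom T) ∧ Nonempty (T.Hom S)) ↔
          (MulAction.fixedPoints G X).Nonempty)) := by
  refine ⟨fun X => GSpace.mem_wes_point_of_fixedPoints_nonempty K, fun X _ _ =>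
    ⟨fun h => ?_, GSpace.mem_wes_point_of_fixedPoints_nonempty K⟩, fun X _ _ S T hS hT =>
    ⟨fun h => ?_, fun h => ?_⟩⟩
  · by_contra hX
    obtain ⟨P, hP, hPfix, ⟨f⟩⟩ := GSpace.exists_map_isGANR_fixedPoints_empty hK_metrizable
      hK_paracompact X hX
    obtain ⟨⟨s⟩, -⟩ := h
    obtain ⟨k, -⟩ := Quotient.exists_rep (s.app P hP (Quotient.mk _ f))
    exact hPfix k.fixedPoints_nonempty
  · by_contra hX
    obtain ⟨P, hP, hPfix, ⟨f⟩⟩ := GSpace.exists_map_isGANR_fixedPoints_empty hK_metrizable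
      hK_paracompact X hX
    obtain ⟨-, ⟨m⟩⟩ := h
    obtain ⟨p, -, hp⟩ := hS
    obtain ⟨q, -, -⟩ := hT
    obtain ⟨a, k, -⟩ := (hp P hP).1 f
    -- The composite runs from the point through `T.obj (m.φ a)` and `S.obj a` to `P`.
    exact hPfix (k.comp ((m.f a).comp (q (m.φ a)))).fixedPoints_nonempty
  · obtain ⟨x, hx⟩ := h
    exact ⟨hS.nonempty_hom hT (GSpace.Map.const X GSpace.point_mem_fixedPoints),
      hT.nonempty_hom hS (GSpace.Map.const _ hx)⟩
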